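/- Let $r:[0,\infty)\to(0,\infty)$ be any positive function with $r(t)\to 0$ as $t\to\infty$. Then there exist a complex Banach space $X$ and a bounded $C_0$-semigroup $(T(t))_{t\ge 0}$ on $X$ (that is, $\sup_{t\ge 0}\|T(t)\|<\infty$), with infinitesimal generator $A$, such that the spectrum of $A$ is empty, $\sigma(A)=\varnothing$ (in particular $A$ has a bounded inverse $A^{-1}$ on $X$), and, for some $x\in X$, $$\limsup_{t\to\infty}\frac{\|T(t)A^{-1}x\|_X}{r(t)}=\infty .$$ -/

import Mathlib

open Filter Topology
open scoped NNReal

/-- A `C₀`-semigroup `(T(t))_{t ≥ 0}` of bounded operators on a complex normed space. -/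
structure C0Semigroup (X : Type*) [NormedAddCommGroup X] [NormedSpace ℂ X] where
  /-- the operator `T(t)` -/
  op : ℝ≥0 → X →L[ℂ] X
  op_zero : op 0 = ContinuousLinearMap.id ℂ X
  op_add : ∀ s t : ℝ≥0, op (s + t) = (op s).comp (op t)
  strong_continuity : ∀ x : X, Tendsto (fun t : ℝ≥0 => op t x) (𝓝[>] 0) (𝓝 x)

namespace C0Semigroup

variable {X : Type*} [NormedAddCommGroup X] [NormedSpace ℂ X]

/-- The semigroup is (uniformly) bounded: `sup_{t ≥ 0} ‖T(t)‖ < ∞`. -/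
def IsBounded (T : C0Semigroup X) : Prop := ∃ M : ℝ, ∀ t : ℝ≥0, ‖T.op t‖ ≤ M

/-- The difference quotient `(T(t)x - x) / t`. -/
noncomputable def diffQuot (T : C0Semigroup X) (x : X) (t : ℝ≥0) : X :=
  (((t : ℝ) : ℂ)⁻¹) • (T.op t x - x)

/-- `y` is the limit of the difference quotients of the orbit of `x` as `t → 0⁺`. -/
def HasGenerator (T : C0Semigroup X) (x y : X) : Prop :=
  Tendsto (T.diffQuot x) (𝓝[>] 0) (𝓝 y)

theorem HasGenerator.add {T : C0Semigroup X} {x₁ x₂ y₁ y₂ : X}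
    (h₁ : T.HasGenerator x₁ y₁) (h₂ : T.HasGenerator x₂ y₂) :
    T.HasGenerator (x₁ + x₂) (y₁ + y₂) := by
  refine (Tendsto.add h₁ h₂).congr fun t => ?_
  simp only [diffQuot, map_add, ← smul_add]
  congr 1
  abel

theorem HasGenerator.smul {T : C0Semigroup X} {x y : X} (c : ℂ)
    (h : T.HasGenerator x y) : T.HasGenerator (c • x) (c • y) := by
  refine (Tendsto.const_smul h c).congr fun t => ?_
  simp only [diffQuot, map_smul, ← smul_sub]
  rw [smul_comm]

theorem HasGenerator.unique {T : C0Semigroup X} {x y z : X}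
    (h₁ : T.HasGenerator x y) (h₂ : T.HasGenerator x z) : y = z :=
  tendsto_nhds_unique h₁ h₂

/-- The infinitesimal generator `A` of the semigroup, as an unbounded operator: its domain is the
set of all `x` for which `lim_{t → 0⁺} (T(t)x - x) / t` exists, and `A x` is this limit. -/
noncomputable def generator (T : C0Semigroup X) : X →ₗ.[ℂ] X where
  domain :=
    { carrier := {x | ∃ y, T.HasGenerator x y}
      add_mem' := fun ⟨_, h₁⟩ ⟨_, h₂⟩ => ⟨_, h₁.add h₂⟩
      zero_mem' := ⟨0, by
        have h : T.diffQuot 0 = fun _ => 0 := by funext t; simp [diffQuot]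
        simp only [HasGenerator, h]
        exact tendsto_const_nhds⟩
      smul_mem' := fun c _ ⟨_, h⟩ => ⟨_, h.smul c⟩ }
  toFun :=
    { toFun := fun x => x.2.choose
      map_add' := fun x y =>
        (x + y).2.choose_spec.unique (x.2.choose_spec.add y.2.choose_spec)
      map_smul' := fun c x => (c • x).2.choose_spec.unique (x.2.choose_spec.smul c) }

end C0Semigroup

namespace UnboundedOperator

variable {X : Type*} [NormedAddCommGroup X] [NormedSpace ℂ X]

/-- The operator `B` is a bounded, everywhere defined, two-sided inverse of the unbounded
operator `S`, that is, `S : D(S) → X` is bijective and `B = S⁻¹` is bounded.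
Such a `B` is unique when it exists. -/
def IsBoundedInverse (S : X →ₗ.[ℂ] X) (B : X →L[ℂ] X) : Prop :=
  (∀ y : X, ∃ h : B y ∈ S.domain, S ⟨B y, h⟩ = y) ∧ ∀ x : S.domain, B (S x) = x

/-- The operator `z - A` with domain `D(A)`. -/
def shift (A : X →ₗ.[ℂ] X) (z : ℂ) : X →ₗ.[ℂ] X where
  domain := A.domain
  toFun := z • A.domain.subtype - A.toFun

/-- The resolvent set `ρ(A)`: all `z` for which `z - A` has a bounded inverse. -/
def resolventSet (A : X →ₗ.[ℂ] X) : Set ℂ :=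
  {z | ∃ B : X →L[ℂ] X, IsBoundedInverse (shift A z) B}

/-- The spectrum `σ(A) = ℂ ∖ ρ(A)` of an unbounded operator. -/
def spectrum (A : X →ₗ.[ℂ] X) : Set ℂ := (resolventSet A)ᶜ

end UnboundedOperator

/-! Slow decay comes from slowing down copies of one good semigroup; rotation keeps the spectrum
from appearing. Take a contraction semigroup `S` with generator `B`, empty spectrum and `‖S(t)B‖ ≤ C
/ t`. On the `ℓ¹`-sum of copies of its space let the `n`-th block be `e^{int} S(aₙ t)`, with
generator `in + aₙ B`. Its resolvent at `z` is `aₙ⁻¹ (ζ - B)⁻¹` with `ζ = (z - in) / aₙ`. For large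
`n` the point `ζ` is close in direction to the imaginary axis, where smoothing gives `‖(ζ - B)⁻¹‖ ≤
C' / |ζ|` (`HasGenerator.norm_mul_norm_le`). The factors `aₙ` cancel, leaving `C' / |z - in|`, so
the sum has empty spectrum for every choice of `aₙ > 0` (`exists_isResolvent_directSum_rescale`).
The `aₙ` can therefore be so small that `S(aₙ tₙ) y` is still near `y` at times `tₙ` where `r` is
tiny.

For `S`, translation on bounded holomorphic functions on a sector is conjugated by `e^{s²}`. The
weight gives `‖S(t)‖ ≤ e^{-t²}`, hence empty spectrum by Laplace transform. Orbits extend boundedly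
to complex times, so Cauchy's estimate gives the smoothing. -/

namespace C0Semigroup

variable {X : Type*} [NormedAddCommGroup X] [NormedSpace ℂ X]

/-! ### Orbits, generators and resolvents. -/

theorem tendsto_nhdsGT_zero_nnreal_iff {α : Type*} {f : ℝ≥0 → α} {l : Filter α} :
    Tendsto f (𝓝[>] 0) l ↔ Tendsto (fun t : ℝ => f t.toNNReal) (𝓝[>] 0) l := by
  constructor
  · intro h
    refine h.comp (tendsto_nhdsWithin_iff.2 ⟨?_, ?_⟩)
    · have := (continuous_real_toNNReal.tendsto 0).mono_left
        (nhdsWithin_le_nhds (s := Set.Ioi (0 : ℝ)))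
      simpa using this
    · filter_upwards [self_mem_nhdsWithin] with t ht
      exact Real.toNNReal_pos.2 ht
  · intro h
    have h2 : Tendsto (fun t : ℝ≥0 => (t : ℝ)) (𝓝[>] 0) (𝓝[>] 0) := by
      refine tendsto_nhdsWithin_iff.2 ⟨?_, ?_⟩
      · exact (NNReal.continuous_coe.tendsto 0).mono_left nhdsWithin_le_nhds
      · filter_upwards [self_mem_nhdsWithin] with t ht
        exact NNReal.coe_pos.2 ht
    refine (h.comp h2).congr fun t => ?_
    simp

theorem ext_op {S T : C0Semigroup X} (h : S.op = T.op) : S = T := by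
  cases S
  cases T
  congr

/-- The orbit `t ↦ T(t)x`, extended by `x` to negative times. -/
def orbit (T : C0Semigroup X) (x : X) (t : ℝ) : X := T.op t.toNNReal x

theorem orbit_zero (T : C0Semigroup X) (x : X) : T.orbit x 0 = x := by
  simp [orbit, T.op_zero]

theorem orbit_coe (T : C0Semigroup X) (x : X) (t : ℝ≥0) : T.orbit x t = T.op t x := by
  simp [orbit]

theorem orbit_add (T : C0Semigroup X) (x : X) (t : ℝ≥0) {s : ℝ} (hs : 0 ≤ s) :
    T.orbit x (t + s) = T.op t (T.orbit x s) := by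
  lift s to ℝ≥0 using hs
  rw [← NNReal.coe_add, orbit_coe, orbit_coe, T.op_add]
  rfl

theorem hasGenerator_iff {T : C0Semigroup X} {x y : X} :
    T.HasGenerator x y ↔ HasDerivWithinAt (T.orbit x) y (Set.Ici 0) 0 := by
  rw [← hasDerivWithinAt_Ioi_iff_Ici, hasDerivWithinAt_iff_tendsto_slope' (by simp),
    HasGenerator, tendsto_nhdsGT_zero_nnreal_iff]
  refine tendsto_congr' ?_
  filter_upwards [self_mem_nhdsWithin] with t ht
  have ht' : (0 : ℝ) < t := ht
  simp only [diffQuot, slope, orbit, vsub_eq_sub, sub_zero, Real.toNNReal_zero, T.op_zero,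
    ContinuousLinearMap.id_apply, Real.coe_toNNReal _ ht'.le]
  rw [← Complex.ofReal_inv, Complex.coe_smul]

theorem hasGenerator_apply (T : C0Semigroup X) (x : T.generator.domain) :
    T.HasGenerator x (T.generator x) :=
  x.2.choose_spec

theorem HasGenerator.generator_apply {T : C0Semigroup X} {x y : X} (h : T.HasGenerator x y) :
    T.generator ⟨x, y, h⟩ = y :=
  (T.hasGenerator_apply ⟨x, y, h⟩).unique h

theorem HasGenerator.neg {T : C0Semigroup X} {x y : X} (h : T.HasGenerator x y) :
    T.HasGenerator (-x) (-y) := by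
  simpa using h.smul (-1)

/-- `R = (z - A)⁻¹`, stated in terms of difference quotients. -/
structure IsResolvent (T : C0Semigroup X) (z : ℂ) (R : X →L[ℂ] X) : Prop where
  hasGenerator : ∀ y, T.HasGenerator (R y) (z • R y - y)
  left_inv : ∀ x y, T.HasGenerator x y → R (z • x - y) = x

theorem IsResolvent.mem_resolventSet {T : C0Semigroup X} {z : ℂ} {R : X →L[ℂ] X}
    (h : T.IsResolvent z R) : z ∈ UnboundedOperator.resolventSet T.generator := by
  refine ⟨R, fun y => ⟨⟨_, h.hasGenerator y⟩, ?_⟩, fun x => ?_⟩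
  · change z • R y - T.generator ⟨R y, _⟩ = y
    rw [(h.hasGenerator y).generator_apply]
    abel
  · exact h.left_inv _ _ (T.hasGenerator_apply x)

/-- The resolvent at `0` inverts `0 - A`, hence the sign. -/
theorem IsResolvent.isBoundedInverse {T : C0Semigroup X} {R : X →L[ℂ] X}
    (h : T.IsResolvent 0 R) : UnboundedOperator.IsBoundedInverse T.generator (-R) := by
  have h1 : ∀ y, T.HasGenerator ((-R) y) y := fun y => by
    simpa using (h.hasGenerator y).neg
  refine ⟨fun y => ⟨⟨_, h1 y⟩, (h1 y).generator_apply⟩, fun x => ?_⟩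
  simpa using h.left_inv _ _ (T.hasGenerator_apply x)

/-- Every orbit is continuous on the whole half-line. -/
def ContinuousOrbits (T : C0Semigroup X) : Prop := ∀ x, Continuous fun t : ℝ≥0 => T.op t x

theorem ContinuousOrbits.continuous_orbit {T : C0Semigroup X} (h : T.ContinuousOrbits) (x : X) :
    Continuous (T.orbit x) :=
  (h x).comp continuous_real_toNNReal

theorem tendsto_op_nhds_zero (T : C0Semigroup X) (x : X) :
    Tendsto (fun t => T.op t x) (𝓝 0) (𝓝 x) := by
  have h : ContinuousWithinAt (fun t => T.op t x) (Set.Ici 0) 0 := by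
    rw [← continuousWithinAt_Ioi_iff_Ici]
    simpa [ContinuousWithinAt, T.op_zero] using T.strong_continuity x
  have h0 : Set.Ici (0 : ℝ≥0) = Set.univ := by ext; simp
  rw [h0, continuousWithinAt_univ] at h
  simpa [ContinuousAt, T.op_zero] using h

theorem IsBounded.continuousOrbits {T : C0Semigroup X} (hT : T.IsBounded) :
    T.ContinuousOrbits := by
  obtain ⟨M, hM⟩ := hT
  intro x
  have key : ∀ s t : ℝ≥0, t ≤ s → ‖T.op s x - T.op t x‖ ≤ M * ‖T.op (nndist s t) x - x‖ := by
    intro s t hts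
    have hs : s = t + nndist s t := by
      apply NNReal.eq
      rw [NNReal.coe_add, coe_nndist, NNReal.dist_eq,
        abs_of_nonneg (sub_nonneg.2 (NNReal.coe_le_coe.2 hts))]
      ring
    conv_lhs => rw [hs, T.op_add]
    rw [ContinuousLinearMap.comp_apply, ← map_sub]
    exact (T.op t).le_of_opNorm_le (hM t) _
  have key' : ∀ s t : ℝ≥0, ‖T.op s x - T.op t x‖ ≤ M * ‖T.op (nndist s t) x - x‖ := by
    intro s t
    rcases le_total t s with h | h
    · exact key s t h
    · rw [norm_sub_rev, nndist_comm]
      exact key t s h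
  refine continuous_iff_continuousAt.2 fun t => ?_
  rw [ContinuousAt, tendsto_iff_norm_sub_tendsto_zero]
  have h1 : Tendsto (fun s : ℝ≥0 => nndist s t) (𝓝 t) (𝓝 0) := by
    have : Continuous fun s : ℝ≥0 => nndist s t := by fun_prop
    simpa using this.tendsto t
  have h2 := (((T.tendsto_op_nhds_zero x).comp h1).sub_const x).norm.const_mul M
  simp only [sub_self, norm_zero, mul_zero] at h2
  exact squeeze_zero (fun _ => norm_nonneg _) (fun s => key' s t) h2

/-- The semigroup law carries the right derivative from `0` to `t`; only right derivatives are
needed below. -/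
theorem HasGenerator.hasDerivWithinAt_orbit {T : C0Semigroup X} {x y : X}
    (h : T.HasGenerator x y) (t : ℝ≥0) :
    HasDerivWithinAt (T.orbit x) (T.op t y) (Set.Ici (t : ℝ)) t := by
  have h1 := hasGenerator_iff.1 h
  have h2 : HasDerivWithinAt (fun u : ℝ => u - t) 1 (Set.Ici (t : ℝ)) t :=
    ((hasDerivAt_id _).sub_const _).hasDerivWithinAt
  have h3 : HasDerivWithinAt (T.orbit x ∘ fun u : ℝ => u - t) ((1 : ℝ) • y) (Set.Ici (t : ℝ)) t := by
    refine HasDerivWithinAt.scomp_of_eq (t' := Set.Ici 0) _ h1 h2 ?_ (by simp)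
    intro u hu
    simpa using hu
  rw [one_smul] at h3
  have h4 := ((T.op t).restrictScalars ℝ).hasFDerivAt.comp_hasDerivWithinAt (t : ℝ) h3
  refine h4.congr_of_mem ?_ (by simp)
  intro u hu
  have hu' : (t : ℝ) ≤ u := hu
  have := T.orbit_add x t (sub_nonneg.2 hu')
  rw [add_sub_cancel] at this
  simpa using this

theorem HasGenerator.hasDerivWithinAt_clm {T : C0Semigroup X} {x y : X}
    (h : T.HasGenerator x y) (φ : X →L[ℂ] ℂ) (t : ℝ≥0) :
    HasDerivWithinAt (fun u => φ (T.orbit x u)) (φ (T.op t y)) (Set.Ici (t : ℝ)) t :=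
  (φ.restrictScalars ℝ).hasFDerivAt.comp_hasDerivWithinAt (t : ℝ) (h.hasDerivWithinAt_orbit t)

/-- Mean value inequality for a continuous function with a bounded right derivative. -/
theorem HasGenerator.norm_op_sub_le {T : C0Semigroup X} (hc : T.ContinuousOrbits) {x y : X}
    (h : T.HasGenerator x y) {t : ℝ≥0} {K : ℝ} (hK : ∀ s < t, ‖T.op s y‖ ≤ K) :
    ‖T.op t x - x‖ ≤ K * t := by
  have := norm_image_sub_le_of_norm_deriv_right_le_segment (f := T.orbit x)
    (f' := fun s => T.op s.toNNReal y) (a := 0) (b := t) (C := K)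
    (hc.continuous_orbit x).continuousOn ?_ ?_ t ⟨t.2, le_rfl⟩
  · simpa [orbit_zero, orbit_coe] using this
  · rintro s ⟨hs, -⟩
    lift s to ℝ≥0 using hs
    simpa using h.hasDerivWithinAt_orbit s
  · rintro s ⟨hs, hst⟩
    lift s to ℝ≥0 using hs
    simpa using hK s (NNReal.coe_lt_coe.1 hst)

/-! ### Rescaling: the generator `A` becomes `c + aA`. -/

/-- The semigroup `t ↦ e^{ct} T(at)`. -/
noncomputable def rescale (T : C0Semigroup X) (a : ℝ≥0) (c : ℂ) : C0Semigroup X where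
  op t := Complex.exp (c * (t : ℝ)) • T.op (a * t)
  op_zero := by simp [T.op_zero]
  op_add s t := by
    ext x
    simp [mul_add, T.op_add, Complex.exp_add, smul_smul, mul_comm]
  strong_continuity x := by
    have h1 : Tendsto (fun t : ℝ≥0 => a * t) (𝓝 0) (𝓝 0) := by
      have : Continuous fun t : ℝ≥0 => a * t := by fun_prop
      simpa using this.tendsto 0
    have h2 : Tendsto (fun t : ℝ≥0 => Complex.exp (c * (t : ℝ))) (𝓝 0) (𝓝 1) := by
      have : Continuous fun t : ℝ≥0 => Complex.exp (c * (t : ℝ)) := by fun_prop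
      simpa using this.tendsto 0
    simpa using (h2.smul ((T.tendsto_op_nhds_zero x).comp h1)).mono_left nhdsWithin_le_nhds

theorem rescale_op (T : C0Semigroup X) (a : ℝ≥0) (c : ℂ) (t : ℝ≥0) :
    (T.rescale a c).op t = Complex.exp (c * (t : ℝ)) • T.op (a * t) := rfl

theorem norm_rescale_op (T : C0Semigroup X) (a : ℝ≥0) (c : ℂ) (t : ℝ≥0) :
    ‖(T.rescale a c).op t‖ = Real.exp (c.re * t) * ‖T.op (a * t)‖ := by
  rw [rescale_op, norm_smul, Complex.norm_exp, Complex.re_mul_ofReal]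

theorem ContinuousOrbits.rescale {T : C0Semigroup X} (h : T.ContinuousOrbits) (a : ℝ≥0) (c : ℂ) :
    (T.rescale a c).ContinuousOrbits := by
  intro x
  have h1 : Continuous fun t : ℝ≥0 => T.op (a * t) x := (h x).comp (by fun_prop)
  have h2 : Continuous fun t : ℝ≥0 => Complex.exp (c * (t : ℝ)) := by fun_prop
  exact h2.smul h1

theorem HasGenerator.rescale {T : C0Semigroup X} {x y : X} (h : T.HasGenerator x y)
    (a : ℝ≥0) (c : ℂ) : (T.rescale a c).HasGenerator x (c • x + ((a : ℝ) : ℂ) • y) := by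
  rw [hasGenerator_iff] at h ⊢
  have h2 : HasDerivWithinAt (fun u : ℝ => a * u) (a : ℝ) (Set.Ici 0) 0 := by
    simpa using ((hasDerivAt_id (0 : ℝ)).const_mul (a : ℝ)).hasDerivWithinAt
  have h3 : HasDerivWithinAt (T.orbit x ∘ fun u : ℝ => a * u) ((a : ℝ) • y) (Set.Ici 0) 0 := by
    refine HasDerivWithinAt.scomp_of_eq (t' := Set.Ici 0) _ h h2 ?_ (by simp)
    intro u hu
    exact mul_nonneg a.2 hu
  have h4 : HasDerivAt (fun u : ℝ => Complex.exp (c * (u : ℂ))) c 0 := by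
    have h5 : HasDerivAt (fun z : ℂ => Complex.exp (c * z)) c ((0 : ℝ) : ℂ) := by
      have := ((hasDerivAt_id ((0 : ℝ) : ℂ)).const_mul c).cexp
      simpa using this
    exact h5.comp_ofReal
  have h6 := h4.hasDerivWithinAt (s := Set.Ici 0) |>.smul h3
  have h7 : Complex.exp (c * ((0 : ℝ) : ℂ)) • ((a : ℝ) • y) +
      c • (T.orbit x ∘ fun u : ℝ => a * u) 0 = c • x + ((a : ℝ) : ℂ) • y := by
    simp [orbit_zero, add_comm]
  rw [h7] at h6
  refine h6.congr_of_mem (fun u hu => ?_) (by simp)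
  have hu' : (0 : ℝ) ≤ u := hu
  simp [orbit, rescale_op, hu', Real.toNNReal_mul (NNReal.coe_nonneg a)]

theorem rescale_rescale_inv (T : C0Semigroup X) {a : ℝ≥0} (ha : a ≠ 0) (c : ℂ) :
    (T.rescale a c).rescale a⁻¹ (-(c / ((a : ℝ) : ℂ))) = T := by
  have h : ((T.rescale a c).rescale a⁻¹ (-(c / ((a : ℝ) : ℂ)))).op = T.op := by
    funext t
    rw [rescale_op, rescale_op, smul_smul, ← Complex.exp_add, mul_inv_cancel_left₀ ha]
    have : -(c / ((a : ℝ) : ℂ)) * ((t : ℝ) : ℂ) + c * (((a⁻¹ * t : ℝ≥0) : ℝ) : ℂ) = 0 := by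
      push_cast
      ring
    rw [this, Complex.exp_zero, one_smul]
  exact C0Semigroup.ext_op h

theorem hasGenerator_rescale_iff {T : C0Semigroup X} {a : ℝ≥0} (ha : a ≠ 0) {c : ℂ} {x y : X} :
    (T.rescale a c).HasGenerator x (c • x + ((a : ℝ) : ℂ) • y) ↔ T.HasGenerator x y := by
  refine ⟨fun h => ?_, fun h => h.rescale a c⟩
  have h1 := h.rescale a⁻¹ (-(c / ((a : ℝ) : ℂ)))
  rw [rescale_rescale_inv T ha] at h1
  convert h1 using 1
  have : ((a : ℝ) : ℂ) ≠ 0 := by exact_mod_cast ha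
  rw [smul_add, smul_smul, smul_smul, ← add_assoc, ← add_smul]
  push_cast
  rw [inv_mul_cancel₀ this, one_smul]
  have h0 : -(c / ((a : ℝ) : ℂ)) + ((a : ℝ) : ℂ)⁻¹ * c = 0 := by field_simp; ring
  rw [h0, zero_smul, zero_add]

theorem IsResolvent.rescale {T : C0Semigroup X} {z : ℂ} {R : X →L[ℂ] X} (h : T.IsResolvent z R)
    {a : ℝ≥0} (ha : a ≠ 0) (c : ℂ) :
    (T.rescale a c).IsResolvent (c + ((a : ℝ) : ℂ) * z) (((a : ℝ) : ℂ)⁻¹ • R) := by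
  have ha' : ((a : ℝ) : ℂ) ≠ 0 := by exact_mod_cast ha
  refine ⟨fun y => ?_, fun x y hxy => ?_⟩
  · have := ((h.hasGenerator y).rescale a c).smul ((a : ℝ) : ℂ)⁻¹
    change (T.rescale a c).HasGenerator (((a : ℝ) : ℂ)⁻¹ • R y)
      ((c + ((a : ℝ) : ℂ) * z) • (((a : ℝ) : ℂ)⁻¹ • R y) - y)
    convert this using 1
    match_scalars <;> field_simp
  · have e : y = c • x + ((a : ℝ) : ℂ) • (((a : ℝ) : ℂ)⁻¹ • (y - c • x)) := by
      rw [smul_smul, mul_inv_cancel₀ ha', one_smul]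
      abel
    rw [e] at hxy
    have h1 := h.left_inv _ _ ((hasGenerator_rescale_iff ha).1 hxy)
    change ((a : ℝ) : ℂ)⁻¹ • R _ = x
    rw [← map_smul]
    conv_rhs => rw [← h1]
    congr 1
    match_scalars <;> field_simp
    ring

end C0Semigroup

namespace C0Semigroup

variable {X : Type*} [NormedAddCommGroup X] [NormedSpace ℂ X]

/-! ### Resolvents of rapidly decaying semigroups by Laplace transform. -/

section ExponentialStability

open MeasureTheory

variable {T : C0Semigroup X} {M : ℝ}

theorem norm_orbit_le_of_exp_decay (hM : ∀ t, ‖T.op t‖ ≤ M * Real.exp (-t)) (y : X) {t : ℝ}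
    (ht : 0 ≤ t) : ‖T.orbit y t‖ ≤ M * ‖y‖ * Real.exp (-t) := by
  lift t to ℝ≥0 using ht
  rw [orbit_coe, mul_right_comm]
  exact (T.op t).le_of_opNorm_le (hM t) y

theorem integrableOn_orbit (hc : T.ContinuousOrbits) (hM : ∀ t, ‖T.op t‖ ≤ M * Real.exp (-t))
    (y : X) : IntegrableOn (T.orbit y) (Set.Ioi 0) := by
  refine Integrable.mono' ((integrableOn_exp_neg_Ioi 0).const_mul (M * ‖y‖))
    ((hc.continuous_orbit y).aestronglyMeasurable) ?_
  filter_upwards [ae_restrict_mem measurableSet_Ioi] with t ht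
  exact norm_orbit_le_of_exp_decay hM y (le_of_lt ht)

/-- `T(h)` moves the integral over `(0, ∞)` to `(h, ∞)`; differentiating at `h = 0` then shows that
the generator sends the integral to `-y`. -/
theorem op_integral_orbit [CompleteSpace X] (hc : T.ContinuousOrbits)
    (hM : ∀ t, ‖T.op t‖ ≤ M * Real.exp (-t)) (y : X) (h : ℝ≥0) :
    T.op h (∫ t in Set.Ioi 0, T.orbit y t) =
      (∫ t in Set.Ioi 0, T.orbit y t) - ∫ t in (0 : ℝ)..h, T.orbit y t := by
  have hint := integrableOn_orbit hc hM y
  rw [← (T.op h).integral_comp_comm hint]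
  have h1 : ∫ t in Set.Ioi (0 : ℝ), T.op h (T.orbit y t) =
      ∫ t in Set.Ioi (0 : ℝ), T.orbit y (h + t) :=
    setIntegral_congr_fun measurableSet_Ioi fun t ht => (T.orbit_add y h (le_of_lt ht)).symm
  have h2 := (measurePreserving_add_left volume (h : ℝ)).setIntegral_preimage_emb
    (measurableEmbedding_addLeft (h : ℝ)) (T.orbit y) (Set.Ioi (h : ℝ))
  rw [Set.preimage_const_add_Ioi, sub_self] at h2
  have h3 := intervalIntegral.integral_Ioi_sub_Ioi hint h.2
  rw [h1, h2]
  exact (sub_eq_of_eq_add' (sub_eq_iff_eq_add.1 h3)).symm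

theorem exists_isResolvent_zero [CompleteSpace X] (hc : T.ContinuousOrbits)
    (hM : ∀ t, ‖T.op t‖ ≤ M * Real.exp (-t)) : ∃ R : X →L[ℂ] X, T.IsResolvent 0 R := by
  have hint := integrableOn_orbit hc hM
  let R : X →L[ℂ] X := LinearMap.mkContinuous
    { toFun := fun y => ∫ t in Set.Ioi 0, T.orbit y t
      map_add' := fun x y => by
        rw [← integral_add (hint x) (hint y)]
        simp [orbit]
      map_smul' := fun c x => by
        rw [RingHom.id_apply, ← integral_smul]
        simp [orbit] } M (fun y => by
      refine (norm_integral_le_of_norm_le ((integrableOn_exp_neg_Ioi 0).const_mul (M * ‖y‖))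
        ?_).trans_eq ?_
      · filter_upwards [ae_restrict_mem measurableSet_Ioi] with t ht
        exact norm_orbit_le_of_exp_decay hM y (le_of_lt ht)
      · rw [integral_const_mul, integral_exp_neg_Ioi_zero, mul_one])
  have hR : ∀ y, R y = ∫ t in Set.Ioi 0, T.orbit y t := fun _ => rfl
  have hgen : ∀ y, T.HasGenerator (R y) (-y) := by
    intro y
    rw [hasGenerator_iff]
    have h1 := ((hc.continuous_orbit y).integral_hasStrictDerivAt 0 0).hasDerivAt.const_sub (R y)
    rw [orbit_zero] at h1
    refine h1.hasDerivWithinAt.congr_of_mem (fun h hh => ?_) (by simp)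
    have hh' : (0 : ℝ) ≤ h := hh
    lift h to ℝ≥0 using hh'
    rw [orbit_coe, hR, op_integral_orbit hc hM]
  refine ⟨R, fun y => by simpa using hgen y, fun x y hxy => ?_⟩
  have hcomm : ∀ t x, R (T.op t x) = T.op t (R x) := by
    intro t x
    rw [hR, hR, ← (T.op t).integral_comp_comm (hint x)]
    refine setIntegral_congr_fun measurableSet_Ioi fun s hs => ?_
    have hs' : (0 : ℝ) ≤ s := le_of_lt hs
    change T.orbit (T.op t x) s = T.op t (T.orbit x s)
    lift s to ℝ≥0 using hs'
    rw [orbit_coe, orbit_coe, ← ContinuousLinearMap.comp_apply, ← ContinuousLinearMap.comp_apply,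
      ← T.op_add, ← T.op_add, add_comm]
  have h1 : T.HasGenerator (R x) (R y) := by
    refine ((R.continuous.tendsto y).comp hxy).congr fun t => ?_
    simp [diffQuot, hcomm]
  have h2 := h1.unique (hgen x)
  rw [zero_smul, zero_sub, map_neg, h2, neg_neg]

/-- A semigroup decaying like a Gaussian has empty spectrum. -/
theorem exists_isResolvent_of_gaussian_decay [CompleteSpace X] (hc : T.ContinuousOrbits)
    (hT : ∀ t, ‖T.op t‖ ≤ Real.exp (-(t : ℝ) ^ 2)) (z : ℂ) :
    ∃ R : X →L[ℂ] X, T.IsResolvent z R := by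
  obtain ⟨R, hR⟩ := exists_isResolvent_zero (T := T.rescale 1 (-z))
    -- This is the exponential of the maximum over `t` of `(1 - Re z) t - t²`.
    (M := Real.exp ((1 - z.re) ^ 2 / 4)) (hc.rescale 1 (-z)) (fun t => by
      rw [norm_rescale_op, one_mul]
      refine (mul_le_mul_of_nonneg_left (hT t) (Real.exp_nonneg _)).trans ?_
      rw [← Real.exp_add, ← Real.exp_add, Complex.neg_re]
      refine Real.exp_le_exp.2 ?_
      nlinarith [sq_nonneg ((1 - z.re) / 2 - (t : ℝ))])
  have h := hR.rescale (a := 1) one_ne_zero z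
  have h1 := rescale_rescale_inv T one_ne_zero (-z)
  simp only [inv_one, NNReal.coe_one, Complex.ofReal_one, div_one, neg_neg] at h1
  rw [h1] at h
  exact ⟨_, by simpa using h⟩

end ExponentialStability

/-! ### Resolvent bound near the imaginary axis. -/

/-- The smoothing estimate `‖T(t)A‖ ≤ C / t` controls the resolvent close to the imaginary axis. -/
theorem HasGenerator.norm_mul_norm_le {T : C0Semigroup X} (hT : ∀ t, ‖T.op t‖ ≤ 1) {C : ℝ}
    (hC : 0 < C) (hsmooth : ∀ (t : ℝ≥0) (x y : X), 0 < t → T.HasGenerator x y →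
      ‖T.op t y‖ ≤ C / t * ‖x‖) {z : ℂ} (hz : 8 * C * |z.re| ≤ ‖z‖) {x y : X}
    (h : T.HasGenerator x y) : ‖z‖ * ‖x‖ ≤ (4 + 16 * C) * ‖z • x - y‖ := by
  rcases eq_or_ne z 0 with rfl | hz0
  · simpa using by positivity
  have hz1 : 0 < ‖z‖ := norm_pos_iff.2 hz0
  set f := z • x - y with hf
  -- This time makes `C / t = ‖z‖ / 4`, so the smoothing term can be absorbed on the left, while
  -- `|Re z| t ≤ 1 / 2` keeps `e^{-zs}` bounded by `2` up to `t`.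
  set t : ℝ≥0 := ⟨4 * C / ‖z‖, by positivity⟩ with ht
  have ht' : (t : ℝ) = 4 * C / ‖z‖ := rfl
  have ht0 : 0 < t := NNReal.coe_pos.1 (by rw [ht']; positivity)
  have hexp : ∀ s ≤ t, Real.exp ((-z).re * s) ≤ 2 := by
    intro s hs
    have h1 : (-z).re * s ≤ 1 / 2 := by
      calc (-z).re * s ≤ |z.re| * t := by
            refine mul_le_mul ?_ (NNReal.coe_le_coe.2 hs) s.2 (abs_nonneg _)
            rw [Complex.neg_re]
            exact neg_le_abs _
        _ ≤ 1 / 2 := by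
            rw [ht', mul_div_assoc', div_le_iff₀ hz1]
            linarith
    calc Real.exp ((-z).re * s) ≤ Real.exp (1 / 2) := Real.exp_le_exp.2 h1
      _ ≤ 2 := by
        have := Real.exp_one_lt_d9
        have h2 : Real.exp (1 / 2) ^ 2 = Real.exp 1 := by
          rw [← Real.exp_nat_mul]
          norm_num
        nlinarith [Real.exp_pos (1 / 2)]
  have hc : T.ContinuousOrbits := IsBounded.continuousOrbits ⟨1, hT⟩
  -- The orbit `e^{-zs} T(s) x` has derivative `-e^{-zs} T(s) f`, so `x` differs from its value at
  -- `t` by a multiple of `‖f‖ t`.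
  have hU : (T.rescale 1 (-z)).HasGenerator x (-f) := by
    convert h.rescale 1 (-z) using 1
    simp only [hf, NNReal.coe_one, Complex.ofReal_one]
    module
  have h1 : ‖(T.rescale 1 (-z)).op t x - x‖ ≤ 2 * ‖f‖ * t := by
    refine hU.norm_op_sub_le (hc.rescale 1 (-z)) fun s hs => ?_
    refine ((T.rescale 1 (-z)).op s).le_of_opNorm_le_of_le (a := 2) ?_ (norm_neg f).le
    rw [norm_rescale_op, one_mul]
    simpa using mul_le_mul (hexp s hs.le) (hT s) (norm_nonneg _) zero_le_two
  have h2 : ‖(T.rescale 1 (-z)).op t x‖ ≤ 2 * ‖T.op t x‖ := by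
    change ‖Complex.exp (-z * (t : ℝ)) • T.op (1 * t) x‖ ≤ _
    rw [norm_smul, Complex.norm_exp, Complex.re_mul_ofReal, one_mul]
    exact mul_le_mul_of_nonneg_right (hexp t le_rfl) (norm_nonneg _)
  have h3 : ‖z‖ * ‖T.op t x‖ ≤ ‖f‖ + C / t * ‖x‖ := by
    rw [← norm_smul, ← map_smul, show z • x = f + y by simp [hf], map_add]
    refine (norm_add_le _ _).trans (add_le_add ?_ (hsmooth t x y ht0 h))
    simpa using (T.op t).le_of_opNorm_le (hT t) f
  have h4 : ‖x‖ ≤ 2 * ‖f‖ * t + 2 * ‖T.op t x‖ := by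
    have := norm_sub_le ((T.rescale 1 (-z)).op t x) ((T.rescale 1 (-z)).op t x - x)
    rw [sub_sub_cancel] at this
    linarith
  have h5 : C / t = ‖z‖ / 4 := by
    rw [ht']
    field_simp
  have h6 : ‖z‖ * t = 4 * C := by
    rw [ht']
    field_simp
  rw [h5] at h3
  have h7 := mul_le_mul_of_nonneg_left h4 hz1.le
  have h8 : ‖z‖ * (2 * ‖f‖ * t + 2 * ‖T.op t x‖) =
      2 * ‖f‖ * (‖z‖ * t) + 2 * (‖z‖ * ‖T.op t x‖) := by ring
  rw [h8, h6] at h7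
  linarith

end C0Semigroup

/-! ### The Gaussian-weighted shift on a holomorphic function space. -/

namespace GaussianShift

open BoundedContinuousFunction

/-- An open convex sector about the positive real axis. -/
def sector : Set ℂ := {z | |z.im| < z.re / 2}

theorem isOpen_sector : IsOpen sector :=
  isOpen_lt (by fun_prop) (by fun_prop)

theorem re_pos {z : ℂ} (hz : z ∈ sector) : 0 < z.re := by
  have h : |z.im| < z.re / 2 := hz
  linarith [abs_nonneg z.im]

theorem add_mem {z w : ℂ} (hz : z ∈ sector) (hw : w ∈ sector) : z + w ∈ sector := by
  have h1 : |z.im| < z.re / 2 := hz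
  have h2 : |w.im| < w.re / 2 := hw
  change |z.im + w.im| < (z.re + w.re) / 2
  linarith [abs_add_le z.im w.im]

theorem add_ofReal_mem {z : ℂ} (hz : z ∈ sector) (t : ℝ≥0) : z + (t : ℝ) ∈ sector := by
  have h1 : |z.im| < z.re / 2 := hz
  simp only [sector, Set.mem_ofPred_eq, Complex.add_im, Complex.ofReal_im, add_zero,
    Complex.add_re, Complex.ofReal_re]
  linarith [t.2]

/-- Arguments in the sector stay below `π / 4` in absolute value, so those of products stay below `π
/ 2`. -/
theorem re_mul_nonneg {z w : ℂ} (hz : z ∈ sector) (hw : w ∈ sector) : 0 ≤ (z * w).re := by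
  have h1 : |z.im| < z.re / 2 := hz
  have h2 : |w.im| < w.re / 2 := hw
  rw [Complex.mul_re]
  have h3 : z.im * w.im ≤ z.re * w.re := by
    calc z.im * w.im ≤ |z.im| * |w.im| := by rw [← abs_mul]; exact le_abs_self _
      _ ≤ z.re * w.re := by
        have := re_pos hz
        have := re_pos hw
        gcongr <;> linarith
  linarith

/-- The weight remains a contraction at complex times `w` in the sector. -/
theorem norm_exp_le_one {s w : ℂ} (hs : s ∈ sector) (hw : w ∈ sector) :
    ‖Complex.exp (-(2 * s * w + w ^ 2))‖ ≤ 1 := by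
  rw [Complex.norm_exp, Real.exp_le_one_iff, Complex.neg_re, neg_nonpos, Complex.add_re,
    mul_assoc, sq]
  have h1 := re_mul_nonneg hs hw
  have h2 := re_mul_nonneg hw hw
  simp only [Complex.mul_re (2 : ℂ), Complex.re_ofNat, Complex.im_ofNat, zero_mul, sub_zero]
  linarith

theorem closedBall_subset_sector {t : ℝ} (ht : 0 < t) :
    Metric.closedBall (t : ℂ) (t / 4) ⊆ sector := by
  intro w hw
  rw [Metric.mem_closedBall, dist_eq_norm] at hw
  have h1 := (Complex.abs_re_le_norm _).trans hw
  have h2 := (Complex.abs_im_le_norm _).trans hw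
  simp only [Complex.sub_re, Complex.ofReal_re, Complex.sub_im, Complex.ofReal_im, sub_zero] at h1 h2
  change |w.im| < w.re / 2
  linarith [(abs_le.1 h1).1]

/-- Extension by zero of a function on the sector. -/
noncomputable def extendZero (h : sector →ᵇ ℂ) : ℂ → ℂ := Function.extend Subtype.val h 0

theorem extendZero_coe (h : sector →ᵇ ℂ) (s : sector) : extendZero h s = h s :=
  Subtype.val_injective.extend_apply _ _ _

theorem extendZero_of_mem (h : sector →ᵇ ℂ) {s : ℂ} (hs : s ∈ sector) :
    extendZero h s = h ⟨s, hs⟩ :=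
  extendZero_coe h ⟨s, hs⟩

theorem norm_weight_mul_le (t : ℝ≥0) (h : sector →ᵇ ℂ) (s : sector) :
    ‖Complex.exp (-(2 * s * (t : ℝ) + ((t : ℝ) : ℂ) ^ 2)) *
      h ⟨s + (t : ℝ), add_ofReal_mem s.2 t⟩‖ ≤ Real.exp (-(t : ℝ) ^ 2) * ‖h‖ := by
  rw [norm_mul]
  refine mul_le_mul ?_ (h.norm_coe_le_norm _) (norm_nonneg _) (Real.exp_nonneg _)
  rw [Complex.norm_exp]
  refine Real.exp_le_exp.2 ?_
  have h1 : (-(2 * (s : ℂ) * (t : ℝ) + ((t : ℝ) : ℂ) ^ 2)).re =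
      -(2 * (s : ℂ).re * t + (t : ℝ) ^ 2) := by
    rw [← Complex.ofReal_pow, Complex.neg_re, Complex.add_re, Complex.re_mul_ofReal,
      Complex.ofReal_re]
    simp
  rw [h1]
  have := mul_nonneg (re_pos s.2).le (NNReal.coe_nonneg t)
  linarith

/-- Translation by `t`, conjugated with multiplication by `e^{s²}`. -/
noncomputable def shiftOp (t : ℝ≥0) : (sector →ᵇ ℂ) →L[ℂ] (sector →ᵇ ℂ) :=
  LinearMap.mkContinuous
    { toFun := fun h => BoundedContinuousFunction.ofNormedAddCommGroup
        (fun s : sector => Complex.exp (-(2 * s * (t : ℝ) + ((t : ℝ) : ℂ) ^ 2)) *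
          h ⟨s + (t : ℝ), add_ofReal_mem s.2 t⟩)
        (by fun_prop) (Real.exp (-(t : ℝ) ^ 2) * ‖h‖) (norm_weight_mul_le t h)
      map_add' := fun f g => by
        ext s
        simp [mul_add]
      map_smul' := fun c f => by
        ext s
        simp
        ring } (Real.exp (-(t : ℝ) ^ 2)) (fun h =>
          BoundedContinuousFunction.norm_ofNormedAddCommGroup_le _ (by positivity)
            (norm_weight_mul_le t h))

theorem shiftOp_apply (t : ℝ≥0) (h : sector →ᵇ ℂ) (s : sector) :
    shiftOp t h s = Complex.exp (-(2 * s * (t : ℝ) + ((t : ℝ) : ℂ) ^ 2)) *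
      h ⟨s + (t : ℝ), add_ofReal_mem s.2 t⟩ := rfl

theorem norm_shiftOp_le (t : ℝ≥0) : ‖shiftOp t‖ ≤ Real.exp (-(t : ℝ) ^ 2) :=
  LinearMap.mkContinuous_norm_le _ (Real.exp_nonneg _) _

theorem norm_shiftOp_le_one (t : ℝ≥0) : ‖shiftOp t‖ ≤ 1 :=
  (norm_shiftOp_le t).trans (Real.exp_le_one_iff.2 (by simp))

theorem shiftOp_zero : shiftOp 0 = ContinuousLinearMap.id ℂ _ := by
  ext h s
  simp [shiftOp_apply]

theorem shiftOp_add (t u : ℝ≥0) : shiftOp (t + u) = (shiftOp t).comp (shiftOp u) := by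
  ext h s
  simp only [shiftOp_apply, ContinuousLinearMap.comp_apply]
  rw [← mul_assoc, ← Complex.exp_add]
  congr 2
  · push_cast
    ring
  · have : (s : ℂ) + ((t + u : ℝ≥0) : ℝ) = s + (t : ℝ) + (u : ℝ) := by
      push_cast
      ring
    simp only [this]

/-- An `ε / 3` argument, using that the operators are contractions. -/
theorem isClosed_setOf_tendsto_op {E : Type*} [NormedAddCommGroup E] [NormedSpace ℂ E]
    {ι : Type*} (l : Filter ι) (op : ι → E →L[ℂ] E) (hop : ∀ i, ‖op i‖ ≤ 1) :
    IsClosed {x | Tendsto (fun i => op i x) l (𝓝 x)} := by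
  refine isClosed_of_closure_subset fun x hx => ?_
  rw [Set.mem_ofPred_eq, Metric.tendsto_nhds]
  intro ε hε
  obtain ⟨y, hy, hxy⟩ := Metric.mem_closure_iff.1 hx (ε / 3) (by linarith)
  filter_upwards [Metric.tendsto_nhds.1 hy (ε / 3) (by linarith)] with i hi
  have h1 : dist (op i x) (op i y) ≤ dist x y := by
    rw [dist_eq_norm, dist_eq_norm, ← map_sub]
    simpa using (op i).le_of_opNorm_le (hop i) (x - y)
  have h2 := dist_triangle4 (op i x) (op i y) y x
  rw [dist_comm y x] at h2
  linarith

theorem isClosed_setOf_differentiableOn :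
    IsClosed {h : sector →ᵇ ℂ | DifferentiableOn ℂ (extendZero h) sector} := by
  refine IsSeqClosed.isClosed fun f g hf hfg => ?_
  refine TendstoLocallyUniformlyOn.differentiableOn (F := fun n => extendZero (f n)) (φ := atTop)
    ?_ (Eventually.of_forall hf) isOpen_sector
  refine TendstoUniformlyOn.tendstoLocallyUniformlyOn ?_
  rw [Metric.tendstoUniformlyOn_iff]
  intro ε hε
  filter_upwards [Metric.tendsto_nhds.1 hfg ε hε] with n hn s hs
  rw [extendZero_of_mem _ hs, extendZero_of_mem _ hs, dist_comm]
  exact (BoundedContinuousFunction.dist_coe_le_dist _).trans_lt hn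

theorem extendZero_shiftOp (t : ℝ≥0) (h : sector →ᵇ ℂ) {s : ℂ} (hs : s ∈ sector) :
    extendZero (shiftOp t h) s =
      Complex.exp (-(2 * s * (t : ℝ) + ((t : ℝ) : ℂ) ^ 2)) * extendZero h (s + (t : ℝ)) := by
  rw [extendZero_of_mem _ hs, shiftOp_apply, extendZero_of_mem _ (add_ofReal_mem hs t)]

/-- Bounded holomorphic functions on the sector whose orbit is strongly continuous. -/
def holoSpace : Submodule ℂ (sector →ᵇ ℂ) where
  carrier := {h | DifferentiableOn ℂ (extendZero h) sector ∧
    Tendsto (fun t => shiftOp t h) (𝓝[>] 0) (𝓝 h)}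
  add_mem' := by
    rintro f g ⟨hf, hf'⟩ ⟨hg, hg'⟩
    refine ⟨(hf.add hg).congr fun s hs => ?_, ?_⟩
    · simp [extendZero_of_mem _ hs]
    · simpa using hf'.add hg'
  zero_mem' := by
    refine ⟨(differentiableOn_const 0).congr fun s hs => ?_, ?_⟩
    · simp [extendZero_of_mem _ hs]
    · simp
  smul_mem' := by
    rintro c f ⟨hf, hf'⟩
    refine ⟨(hf.const_smul c).congr fun s hs => ?_, ?_⟩
    · simp [extendZero_of_mem _ hs]
    · simpa using hf'.const_smul c

theorem isClosed_holoSpace : IsClosed (holoSpace : Set (sector →ᵇ ℂ)) :=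
  isClosed_setOf_differentiableOn.inter
    (isClosed_setOf_tendsto_op _ shiftOp norm_shiftOp_le_one)

instance : CompleteSpace holoSpace :=
  isClosed_holoSpace.completeSpace_coe

theorem shiftOp_mem (t : ℝ≥0) {h : sector →ᵇ ℂ} (hh : h ∈ holoSpace) :
    shiftOp t h ∈ holoSpace := by
  obtain ⟨h1, h2⟩ := hh
  constructor
  · have h3 : DifferentiableOn ℂ (fun s : ℂ =>
        Complex.exp (-(2 * s * (t : ℝ) + ((t : ℝ) : ℂ) ^ 2)) * extendZero h (s + (t : ℝ)))
        sector := by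
      refine DifferentiableOn.mul (by fun_prop) ?_
      exact h1.comp (by fun_prop) fun s hs => add_ofReal_mem hs t
    exact h3.congr fun s hs => extendZero_shiftOp t h hs
  · refine (((shiftOp t).continuous.tendsto h).comp h2).congr fun u => ?_
    simp only [Function.comp_apply]
    rw [← ContinuousLinearMap.comp_apply, ← ContinuousLinearMap.comp_apply, ← shiftOp_add,
      ← shiftOp_add, add_comm]

/-- The weighted left shift semigroup on `holoSpace`. -/
noncomputable def semigroup : C0Semigroup holoSpace where
  op t := ((shiftOp t).comp holoSpace.subtypeL).codRestrict holoSpace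
    fun h => shiftOp_mem t h.2
  op_zero := by
    ext h : 2
    simp [shiftOp_zero]
  op_add s t := by
    ext h : 2
    exact congrArg (fun f => f (h : sector →ᵇ ℂ)) (shiftOp_add s t)
  strong_continuity h := by
    rw [tendsto_subtype_rng]
    exact h.2.2

theorem norm_semigroup_op_le (t : ℝ≥0) : ‖semigroup.op t‖ ≤ Real.exp (-(t : ℝ) ^ 2) :=
  ContinuousLinearMap.opNorm_le_bound _ (Real.exp_nonneg _) fun h =>
    (shiftOp t).le_of_opNorm_le (norm_shiftOp_le t) (h : sector →ᵇ ℂ)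

/-! ### Complex times and the smoothing estimate. -/

/-- The orbit of `h`, evaluated at `s` and continued to complex times in the sector. -/
noncomputable def complexOrbit (h : sector →ᵇ ℂ) (s w : ℂ) : ℂ :=
  Complex.exp (-(2 * s * w + w ^ 2)) * extendZero h (s + w)

theorem shiftOp_apply_eq_complexOrbit (t : ℝ≥0) (h : sector →ᵇ ℂ) (s : sector) :
    shiftOp t h s = complexOrbit h s (t : ℝ) := by
  rw [complexOrbit, shiftOp_apply, extendZero_of_mem _ (add_ofReal_mem s.2 t)]

theorem differentiableOn_complexOrbit {h : sector →ᵇ ℂ}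
    (hh : DifferentiableOn ℂ (extendZero h) sector) {s : ℂ} (hs : s ∈ sector) :
    DifferentiableOn ℂ (complexOrbit h s) sector := by
  refine DifferentiableOn.mul (by fun_prop) ?_
  exact hh.comp (by fun_prop) fun w hw => add_mem hs hw

theorem norm_complexOrbit_le (h : sector →ᵇ ℂ) {s w : ℂ} (hs : s ∈ sector) (hw : w ∈ sector) :
    ‖complexOrbit h s w‖ ≤ ‖h‖ := by
  rw [complexOrbit, norm_mul, extendZero_of_mem _ (add_mem hs hw)]
  have := mul_le_mul (norm_exp_le_one hs hw)
    (h.norm_coe_le_norm ⟨_, add_mem hs hw⟩) (norm_nonneg _) zero_le_one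
  rwa [one_mul] at this

/-- Cauchy's estimate on the circle of radius `t / 4` about `t`, which lies in the sector; the bound
is uniform in `s`. -/
theorem norm_deriv_complexOrbit_le {h : sector →ᵇ ℂ}
    (hh : DifferentiableOn ℂ (extendZero h) sector) {s : ℂ} (hs : s ∈ sector) {t : ℝ}
    (ht : 0 < t) : ‖deriv (complexOrbit h s) t‖ ≤ 4 / t * ‖h‖ := by
  have hball := closedBall_subset_sector ht
  have : ‖deriv (complexOrbit h s) t‖ ≤ ‖h‖ / (t / 4) := by
    refine Complex.norm_deriv_le_of_forall_mem_sphere_norm_le (by positivity) ?_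
      fun w hw => norm_complexOrbit_le h hs (hball (Metric.sphere_subset_closedBall hw))
    refine DifferentiableOn.diffContOnCl ((differentiableOn_complexOrbit hh hs).mono ?_)
    exact (Metric.closure_ball_subset_closedBall).trans hball
  refine this.trans_eq ?_
  field_simp

theorem hasDerivWithinAt_complexOrbit {x y : holoSpace} (hxy : semigroup.HasGenerator x y)
    (s : sector) (t : ℝ≥0) :
    HasDerivWithinAt (fun u : ℝ => complexOrbit x s u) (shiftOp t y s) (Set.Ici (t : ℝ)) t := by
  have h3 := hxy.hasDerivWithinAt_clm
    ((BoundedContinuousFunction.evalCLM ℂ s).comp holoSpace.subtypeL) t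
  refine h3.congr_of_mem (fun u hu => ?_) Set.self_mem_Ici
  have hu' : (0 : ℝ) ≤ u := t.2.trans hu
  lift u to ℝ≥0 using hu'
  rw [C0Semigroup.orbit_coe]
  exact (shiftOp_apply_eq_complexOrbit u x s).symm

/-- At each `s`, the value of `S(t)Bx` is the right derivative of the orbit, hence the complex
derivative of its holomorphic extension. -/
theorem norm_semigroup_op_generator_le {t : ℝ≥0} (ht : 0 < t) {x y : holoSpace}
    (hxy : semigroup.HasGenerator x y) : ‖semigroup.op t y‖ ≤ 4 / t * ‖x‖ := by
  have ht' : (0 : ℝ) < t := ht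
  refine (BoundedContinuousFunction.norm_le (f := shiftOp t y)
    (mul_nonneg (by positivity) (norm_nonneg x))).2 fun s => ?_
  have htmem : ((t : ℝ) : ℂ) ∈ sector :=
    closedBall_subset_sector ht' (Metric.mem_closedBall_self (by positivity))
  have h1 : HasDerivWithinAt (fun u : ℝ => complexOrbit x s u)
      (deriv (complexOrbit x s) (t : ℝ)) (Set.Ici (t : ℝ)) t :=
    (((differentiableOn_complexOrbit x.2.1 s.2).differentiableAt
      (isOpen_sector.mem_nhds htmem)).hasDerivAt.comp_ofReal).hasDerivWithinAt
  rw [(uniqueDiffWithinAt_Ici _).eq_deriv _ (hasDerivWithinAt_complexOrbit hxy s t) h1]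
  exact norm_deriv_complexOrbit_le x.2.1 s.2 ht'

/-! ### A nonzero element of the space. -/

theorem norm_exp_neg_sub_one_le {w : ℂ} (hw : 0 ≤ w.re) : ‖Complex.exp (-w) - 1‖ ≤ ‖w‖ := by
  have := (convex_halfSpace_re_ge 0).norm_image_sub_le_of_norm_hasDerivWithin_le
    (f := fun z : ℂ => Complex.exp (-z)) (f' := fun z => -Complex.exp (-z)) (C := 1) (x := 0)
    (y := w) (fun z _ => by
      simpa using ((hasDerivAt_id z).neg.cexp).hasDerivWithinAt) (fun z hz => by
      have hz' : 0 ≤ z.re := hz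
      rw [norm_neg, Complex.norm_exp, Real.exp_le_one_iff]
      simpa using hz') (by simp) hw
  simpa using this

/-- The function `s ↦ e^{-s}` on the sector. -/
noncomputable def expNeg : sector →ᵇ ℂ :=
  BoundedContinuousFunction.ofNormedAddCommGroup (fun s : sector => Complex.exp (-(s : ℂ)))
    (by fun_prop) 1 (fun s => by
      rw [Complex.norm_exp, Real.exp_le_one_iff]
      simpa using (re_pos s.2).le)

theorem expNeg_apply (s : sector) : expNeg s = Complex.exp (-(s : ℂ)) := rfl

/-- The weight varies by an amount of order `t |s|`, unbounded in `s`; the decay of `e^{-s}` on the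
sector compensates for the factor `|s|`. -/
theorem norm_shiftOp_expNeg_sub_le (t : ℝ≥0) :
    ‖shiftOp t expNeg - expNeg‖ ≤ 4 * t + (t : ℝ) ^ 2 := by
  refine (BoundedContinuousFunction.norm_le (by positivity)).2 fun s => ?_
  have hs := re_pos s.2
  have hs' : |(s : ℂ).im| < (s : ℂ).re / 2 := s.2
  set w : ℂ := ((2 * t : ℝ) : ℂ) * s + ((t + t ^ 2 : ℝ) : ℂ) with hw
  have h1 : (shiftOp t expNeg - expNeg) s = Complex.exp (-(s : ℂ)) * (Complex.exp (-w) - 1) := by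
    rw [BoundedContinuousFunction.sub_apply, shiftOp_apply, expNeg_apply, expNeg_apply, mul_sub,
      mul_one, ← Complex.exp_add, ← Complex.exp_add, hw]
    congr 2
    push_cast
    ring
  have hwre : 0 ≤ w.re := by
    rw [hw, Complex.add_re, Complex.re_ofReal_mul, Complex.ofReal_re]
    positivity
  have h2 : ‖w‖ ≤ 2 * t * (3 / 2 * (s : ℂ).re) + (t + (t : ℝ) ^ 2) := by
    refine (norm_add_le _ _).trans (add_le_add ?_ ?_)
    · rw [norm_mul, Complex.norm_of_nonneg (by positivity)]
      refine mul_le_mul_of_nonneg_left ?_ (by positivity)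
      refine (Complex.norm_le_abs_re_add_abs_im _).trans ?_
      rw [abs_of_pos hs]
      linarith
    · rw [Complex.norm_of_nonneg (by positivity)]
  have h3 : (s : ℂ).re * Real.exp (-(s : ℂ).re) ≤ 1 := by
    have := Real.add_one_le_exp (s : ℂ).re
    rw [Real.exp_neg, ← div_eq_mul_inv, div_le_one (Real.exp_pos _)]
    linarith
  have h4 : Real.exp (-(s : ℂ).re) ≤ 1 := Real.exp_le_one_iff.2 (by linarith)
  rw [h1, norm_mul, Complex.norm_exp, Complex.neg_re]
  calc Real.exp (-(s : ℂ).re) * ‖Complex.exp (-w) - 1‖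
      ≤ Real.exp (-(s : ℂ).re) * (2 * t * (3 / 2 * (s : ℂ).re) + (t + (t : ℝ) ^ 2)) :=
        mul_le_mul_of_nonneg_left ((norm_exp_neg_sub_one_le hwre).trans h2) (Real.exp_nonneg _)
    _ = 3 * t * ((s : ℂ).re * Real.exp (-(s : ℂ).re)) +
        (t + (t : ℝ) ^ 2) * Real.exp (-(s : ℂ).re) := by ring
    _ ≤ 3 * t * 1 + (t + (t : ℝ) ^ 2) * 1 := by gcongr
    _ = 4 * t + (t : ℝ) ^ 2 := by ring

theorem expNeg_mem : expNeg ∈ holoSpace := by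
  constructor
  · have : DifferentiableOn ℂ (fun s : ℂ => Complex.exp (-s)) sector := by fun_prop
    exact this.congr fun s hs => extendZero_of_mem _ hs
  · rw [tendsto_iff_norm_sub_tendsto_zero]
    refine squeeze_zero (fun _ => norm_nonneg _) norm_shiftOp_expNeg_sub_le ?_
    have : Continuous fun t : ℝ≥0 => 4 * (t : ℝ) + (t : ℝ) ^ 2 := by fun_prop
    exact ((this.tendsto 0).mono_left nhdsWithin_le_nhds).trans (by simp)

instance : Nontrivial holoSpace := by
  refine ⟨⟨expNeg, expNeg_mem⟩, 0, fun h => ?_⟩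
  have h1 : (1 : ℂ) ∈ sector := by simp [sector]
  have h2 := congrArg (fun f : holoSpace => (f : sector →ᵇ ℂ) ⟨1, h1⟩) h
  exact Complex.exp_ne_zero _ h2

end GaussianShift

namespace C0Semigroup

/-! ### `ℓ¹`-sums of contraction semigroups. -/

section DirectSum

variable {ι : Type*} {Y : Type*} [NormedAddCommGroup Y]

theorem summable_norm_lp_one (x : lp (fun _ : ι => Y) 1) : Summable fun i => ‖x i‖ := by
  simpa using (lp.memℓp x).summable (by simp)

theorem norm_lp_one_eq_tsum (x : lp (fun _ : ι => Y) 1) : ‖x‖ = ∑' i, ‖x i‖ := by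
  simpa using lp.norm_eq_tsum_rpow (p := 1) (by simp) x

theorem tendsto_lp_one_of_dominated {α : Type*} {l : Filter α} {F : α → lp (fun _ : ι => Y) 1}
    {g : lp (fun _ : ι => Y) 1} {b : ι → ℝ} (hb : Summable b)
    (hF : ∀ i, Tendsto (fun t => F t i) l (𝓝 (g i))) (hFb : ∀ᶠ t in l, ∀ i, ‖F t i‖ ≤ b i) :
    Tendsto F l (𝓝 g) := by
  rw [tendsto_iff_norm_sub_tendsto_zero]
  have h := tendsto_tsum_of_dominated_convergence (𝓕 := l) (f := fun t i => ‖F t i - g i‖)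
    (g := fun _ => (0 : ℝ)) (hb.add (summable_norm_lp_one g))
    (fun i => tendsto_iff_norm_sub_tendsto_zero.1 (hF i)) (by
      filter_upwards [hFb] with t ht i
      rw [norm_norm]
      exact (norm_sub_le _ _).trans (by linarith [ht i]))
  simp only [tsum_zero] at h
  refine h.congr fun t => ?_
  rw [norm_lp_one_eq_tsum]
  rfl

variable [NormedSpace ℂ Y]

/-- The `ℓ¹`-direct sum of a family of contraction semigroups. -/
noncomputable def directSum (T : ι → C0Semigroup Y) (hT : ∀ i t, ‖(T i).op t‖ ≤ 1) :
    C0Semigroup (lp (fun _ : ι => Y) 1) where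
  op t := lp.mapCLM 1 (fun i => (T i).op t) zero_le_one fun i => hT i t
  op_zero := by
    ext x i
    simp [(T i).op_zero]
  op_add s t := by
    ext x i
    simp [(T i).op_add]
  strong_continuity x := by
    refine tendsto_lp_one_of_dominated (summable_norm_lp_one x)
      (fun i => (T i).strong_continuity (x i)) (Eventually.of_forall fun t i => ?_)
    simpa using ((T i).op t).le_of_opNorm_le (hT i t) (x i)

variable {T : ι → C0Semigroup Y} {hT : ∀ i t, ‖(T i).op t‖ ≤ 1}

theorem directSum_op_apply (t : ℝ≥0) (x : lp (fun _ : ι => Y) 1) (i : ι) :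
    (directSum T hT).op t x i = (T i).op t (x i) := rfl

theorem norm_directSum_op_le (t : ℝ≥0) : ‖(directSum T hT).op t‖ ≤ 1 :=
  lp.norm_mapCLM_le 1 _ zero_le_one fun i => hT i t

theorem directSum_diffQuot_apply (t : ℝ≥0) (x : lp (fun _ : ι => Y) 1) (i : ι) :
    (directSum T hT).diffQuot x t i = (T i).diffQuot (x i) t := rfl

/-- Coordinatewise limits suffice: contractivity bounds the `i`-th difference quotient by `‖y i‖`,
which is summable, so dominated convergence applies. -/
theorem hasGenerator_directSum_iff {x y : lp (fun _ : ι => Y) 1} :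
    (directSum T hT).HasGenerator x y ↔ ∀ i, (T i).HasGenerator (x i) (y i) := by
  constructor
  · intro h i
    exact ((lp.evalCLM ℂ (fun _ : ι => Y) 1 i).continuous.tendsto y).comp h
  · intro h
    refine tendsto_lp_one_of_dominated (summable_norm_lp_one y) (fun i => h i) ?_
    filter_upwards [self_mem_nhdsWithin] with t ht i
    have ht' : (0 : ℝ) < t := ht
    have hc : (T i).ContinuousOrbits := IsBounded.continuousOrbits ⟨1, hT i⟩
    have h1 := (h i).norm_op_sub_le hc (t := t) (K := ‖y i‖) fun s _ => by
      simpa using ((T i).op s).le_of_opNorm_le (hT i s) (y i)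
    rw [directSum_diffQuot_apply, diffQuot, norm_smul, norm_inv,
      Complex.norm_of_nonneg ht'.le, inv_mul_le_iff₀ ht', mul_comm]
    exact h1

theorem IsResolvent.directSum {z : ℂ} {R : ι → Y →L[ℂ] Y} (hR : ∀ i, (T i).IsResolvent z (R i))
    {K : ℝ} (hK : 0 ≤ K) (hRK : ∀ i, ‖R i‖ ≤ K) :
    (directSum T hT).IsResolvent z (lp.mapCLM 1 R hK hRK) := by
  refine ⟨fun y => hasGenerator_directSum_iff.2 fun i => (hR i).hasGenerator (y i),
    fun x y hxy => ?_⟩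
  ext i
  exact (hR i).left_inv _ _ (hasGenerator_directSum_iff.1 hxy i)

end DirectSum

/-! ### Rotated and slowed-down summands. -/

variable {Y : Type*} [NormedAddCommGroup Y] [NormedSpace ℂ Y] {S : C0Semigroup Y}

theorem norm_rescale_I_op_le (hS : ∀ t, ‖S.op t‖ ≤ 1) (a : ℝ≥0) (ω : ℝ) (t : ℝ≥0) :
    ‖(S.rescale a (ω * Complex.I)).op t‖ ≤ 1 := by
  rw [norm_rescale_op]
  simpa using hS (a * t)

theorem IsResolvent.norm_le (hS : ∀ t, ‖S.op t‖ ≤ 1) {C : ℝ} (hC : 0 < C)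
    (hsmooth : ∀ (t : ℝ≥0) (x y : Y), 0 < t → S.HasGenerator x y → ‖S.op t y‖ ≤ C / t * ‖x‖)
    {z : ℂ} (hz0 : z ≠ 0) (hz : 8 * C * |z.re| ≤ ‖z‖) {R : Y →L[ℂ] Y} (hR : S.IsResolvent z R) :
    ‖R‖ ≤ (4 + 16 * C) / ‖z‖ := by
  refine ContinuousLinearMap.opNorm_le_bound _ (by positivity) fun y => ?_
  have h := (hR.hasGenerator y).norm_mul_norm_le hS hC hsmooth hz
  rw [sub_sub_cancel] at h
  rw [div_mul_eq_mul_div, le_div_iff₀ (norm_pos_iff.2 hz0)]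
  linarith

/-- Rotating the summands at frequencies tending to infinity keeps the resolvents of the summands
uniformly bounded at each point of the plane, whatever the time scales are. -/
theorem exists_isResolvent_directSum_rescale (hS : ∀ t, ‖S.op t‖ ≤ 1) {C : ℝ} (hC : 0 < C)
    (hsmooth : ∀ (t : ℝ≥0) (x y : Y), 0 < t → S.HasGenerator x y → ‖S.op t y‖ ≤ C / t * ‖x‖)
    (hres : ∀ z, ∃ R : Y →L[ℂ] Y, S.IsResolvent z R) {a : ℕ → ℝ≥0} (ha : ∀ n, a n ≠ 0)
    {ω : ℕ → ℝ} (hω : Tendsto ω atTop atTop) (z : ℂ) :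
    ∃ R : lp (fun _ : ℕ => Y) 1 →L[ℂ] lp (fun _ : ℕ => Y) 1,
      (directSum (fun n => S.rescale (a n) (ω n * Complex.I))
        fun n => norm_rescale_I_op_le hS (a n) (ω n)).IsResolvent z R := by
  set ζ : ℕ → ℂ := fun n => ((a n : ℝ) : ℂ)⁻¹ * (z - ω n * Complex.I) with hζ
  choose R hR using fun n => hres (ζ n)
  have ha' : ∀ n, ((a n : ℝ) : ℂ) ≠ 0 := fun n => by exact_mod_cast ha n
  have hR' : ∀ n, (S.rescale (a n) (ω n * Complex.I)).IsResolvent z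
      (((a n : ℝ) : ℂ)⁻¹ • R n) := by
    intro n
    have := (hR n).rescale (ha n) (ω n * Complex.I)
    rwa [hζ, mul_inv_cancel_left₀ (ha' n), add_sub_cancel] at this
  have hbound : ∀ᶠ n in atTop, ‖((a n : ℝ) : ℂ)⁻¹ • R n‖ ≤ 4 + 16 * C := by
    -- Beyond this threshold `‖z - iωₙ‖ ≥ 8C‖z‖ + 1`, which puts `ζ n` in the region of the
    -- resolvent bound whatever `a n` is.
    filter_upwards [hω.eventually_ge_atTop ((8 * C + 1) * ‖z‖ + 1)] with n hn
    have hpos : 0 < (a n : ℝ) := NNReal.coe_pos.2 (pos_iff_ne_zero.2 (ha n))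
    have h1 : 8 * C * ‖z‖ + 1 ≤ ‖z - ω n * Complex.I‖ := by
      have h2 : ω n ≤ ‖(ω n : ℂ) * Complex.I‖ := by simpa using le_abs_self (ω n)
      have h3 := norm_sub_norm_le ((ω n : ℂ) * Complex.I) z
      rw [norm_sub_rev] at h3
      linarith
    have h4 : 1 ≤ ‖z - ω n * Complex.I‖ := le_trans (by
      have := mul_nonneg (mul_nonneg (by norm_num : (0 : ℝ) ≤ 8) hC.le) (norm_nonneg z)
      linarith) h1
    have hnorm : ‖ζ n‖ = (a n : ℝ)⁻¹ * ‖z - ω n * Complex.I‖ := by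
      rw [hζ, norm_mul, norm_inv, Complex.norm_of_nonneg hpos.le]
    have hre : (ζ n).re = (a n : ℝ)⁻¹ * z.re := by
      rw [hζ]
      simp only
      rw [← Complex.ofReal_inv, Complex.re_ofReal_mul]
      simp
    have hζ0 : ζ n ≠ 0 := by
      rw [← norm_pos_iff, hnorm]
      positivity
    have h5 := (hR n).norm_le hS hC hsmooth hζ0 (by
      rw [hre, hnorm, abs_mul, abs_of_pos (inv_pos.2 hpos), mul_left_comm]
      refine mul_le_mul_of_nonneg_left ?_ (inv_nonneg.2 hpos.le)
      have := mul_le_mul_of_nonneg_left (Complex.abs_re_le_norm z)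
        (mul_nonneg (by norm_num : (0 : ℝ) ≤ 8) hC.le)
      linarith)
    rw [norm_smul, norm_inv, Complex.norm_of_nonneg hpos.le]
    calc (a n : ℝ)⁻¹ * ‖R n‖ ≤ (a n : ℝ)⁻¹ * ((4 + 16 * C) / ‖ζ n‖) := by gcongr
      _ = (4 + 16 * C) / ‖z - ω n * Complex.I‖ := by
        rw [hnorm]
        field_simp
      _ ≤ 4 + 16 * C := div_le_self (by positivity) h4
  -- The finitely many remaining resolvents are bounded individually, as the spectrum of `S` is
  -- empty.
  obtain ⟨K, hK⟩ := (isBoundedUnder_of_eventually_le hbound).bddAbove_range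
  have hK' : ∀ n, ‖((a n : ℝ) : ℂ)⁻¹ • R n‖ ≤ K := fun n => hK ⟨n, rfl⟩
  exact ⟨_, IsResolvent.directSum hR' ((norm_nonneg _).trans (hK' 0)) hK'⟩

theorem IsResolvent.exists_ne_zero_hasGenerator [Nontrivial Y] {z : ℂ} {R : Y →L[ℂ] Y}
    (hR : S.IsResolvent z R) : ∃ x y, x ≠ 0 ∧ S.HasGenerator x y := by
  obtain ⟨v, hv⟩ := exists_ne (0 : Y)
  refine ⟨R v, _, fun h => hv ?_, hR.hasGenerator v⟩
  have h1 := hR.hasGenerator v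
  rw [h, smul_zero, zero_sub] at h1
  have h2 : S.HasGenerator 0 0 := by simpa using h1.smul 0
  simpa using h1.unique h2

/-- With `w = By`, this sequence is the generator applied to `(2⁻ⁿ y)ₙ`; the geometric weights
absorb the frequencies `n`. -/
theorem memℓp_geometric_smul (y w : Y) {a : ℕ → ℝ≥0} (ha : ∀ n, a n ≤ 1) :
    Memℓp (fun n : ℕ => ((1 / 2 : ℂ) ^ n) •
      (((n : ℝ) * Complex.I : ℂ) • y + ((a n : ℝ) : ℂ) • w)) 1 := by
  refine memℓp_gen ?_
  simp only [ENNReal.toReal_one, Real.rpow_one]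
  have h1 : Summable fun n : ℕ => (n : ℝ) * (1 / 2) ^ n * ‖y‖ + (1 / 2) ^ n * ‖w‖ := by
    refine Summable.add (Summable.mul_right _ ?_) (Summable.mul_right _
      (summable_geometric_of_lt_one (by norm_num) (by norm_num)))
    simpa using summable_pow_mul_geometric_of_norm_lt_one (R := ℝ) 1
      (r := 1 / 2) (by norm_num)
  refine Summable.of_nonneg_of_le (fun _ => norm_nonneg _) (fun n => ?_) h1
  have h2 : ‖((n : ℝ) * Complex.I : ℂ) • y + ((a n : ℝ) : ℂ) • w‖ ≤ n * ‖y‖ + 1 * ‖w‖ := by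
    refine (norm_add_le _ _).trans (add_le_add ?_ ?_)
    · simp [norm_smul]
    · rw [norm_smul, Complex.norm_of_nonneg (NNReal.coe_nonneg (a n))]
      exact mul_le_mul_of_nonneg_right (by exact_mod_cast ha n) (norm_nonneg _)
  calc ‖((1 / 2 : ℂ) ^ n) • (((n : ℝ) * Complex.I : ℂ) • y + ((a n : ℝ) : ℂ) • w)‖
      = (1 / 2) ^ n * ‖((n : ℝ) * Complex.I : ℂ) • y + ((a n : ℝ) : ℂ) • w‖ := by
        rw [norm_smul]
        simp
    _ ≤ (1 / 2) ^ n * (n * ‖y‖ + 1 * ‖w‖) := by gcongr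
    _ = _ := by ring

/-- A contraction semigroup with empty spectrum and the smoothing estimate `‖S(t)B‖ ≤ C / t` gives
rise to bounded semigroups with empty spectrum whose classical orbits decay arbitrarily slowly. -/
theorem exists_arbitrarily_slow_decay {Y : Type} [NormedAddCommGroup Y] [NormedSpace ℂ Y]
    [CompleteSpace Y] [Nontrivial Y] {S : C0Semigroup Y} (hS : ∀ t, ‖S.op t‖ ≤ 1)
    {C : ℝ} (hC : 0 < C)
    (hsmooth : ∀ (t : ℝ≥0) (x y : Y), 0 < t → S.HasGenerator x y → ‖S.op t y‖ ≤ C / t * ‖x‖)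
    (hres : ∀ z, ∃ R : Y →L[ℂ] Y, S.IsResolvent z R)
    {r : ℝ≥0 → ℝ} (hr_pos : ∀ t, 0 < r t) (hr_lim : Tendsto r atTop (𝓝 0)) :
    ∃ (X : Type) (_ : NormedAddCommGroup X) (_ : NormedSpace ℂ X) (_ : CompleteSpace X)
      (T : C0Semigroup X),
      T.IsBounded ∧
      UnboundedOperator.spectrum T.generator = ∅ ∧
      ∃ Ainv : X →L[ℂ] X, UnboundedOperator.IsBoundedInverse T.generator Ainv ∧
        ∃ x : X,
          limsup (fun t : ℝ≥0 => ((‖T.op t (Ainv x)‖ / r t : ℝ) : EReal)) atTop = ⊤ := by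
  obtain ⟨R₀, hR₀⟩ := hres 0
  obtain ⟨y, w, hy, hyw⟩ := hR₀.exists_ne_zero_hasGenerator
  have hy' : 0 < ‖y‖ := norm_pos_iff.2 hy
  have ht : ∀ n : ℕ, ∃ t : ℝ≥0, (n : ℝ≥0) ≤ t ∧ r t ≤ (1 / 4) ^ n := fun n =>
    ((eventually_ge_atTop (n : ℝ≥0)).and
      (hr_lim.eventually_le_const (by positivity : (0 : ℝ) < (1 / 4) ^ n))).exists
  choose t htn htr using ht
  -- The slowdown `a n` is chosen after `t n`, so small that the orbit of `y` has kept half its norm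
  -- at time `a n * t n`.
  have ha : ∀ n : ℕ, ∃ a : ℝ≥0, 0 < a ∧ a ≤ 1 ∧ ‖y‖ / 2 ≤ ‖S.op (a * t n) y‖ := by
    intro n
    have h1 : Tendsto (fun a : ℝ≥0 => a * t n) (𝓝 0) (𝓝 0) := by
      have : Continuous fun a : ℝ≥0 => a * t n := by fun_prop
      simpa using this.tendsto 0
    have h2 := (((S.tendsto_op_nhds_zero y).comp h1).norm.eventually_const_le
      (half_lt_self hy')).filter_mono (nhdsWithin_le_nhds (s := Set.Ioi 0))
    have h3 : ∀ᶠ a : ℝ≥0 in 𝓝[>] 0, a ≤ 1 :=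
      (eventually_le_nhds zero_lt_one).filter_mono nhdsWithin_le_nhds
    obtain ⟨a, ha1, ha2, ha3⟩ := (h2.and (h3.and self_mem_nhdsWithin)).exists
    exact ⟨a, ha3, ha2, ha1⟩
  choose a ha0 ha1 ha using ha
  have hω : Tendsto (fun n : ℕ => (n : ℝ)) atTop atTop := tendsto_natCast_atTop_atTop
  set T := directSum (fun n : ℕ => S.rescale (a n) ((n : ℝ) * Complex.I))
    fun n => norm_rescale_I_op_le hS (a n) (n : ℝ) with hT_def
  have hTres : ∀ z, ∃ R, T.IsResolvent z R := exists_isResolvent_directSum_rescale hS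
    hC hsmooth hres
    (fun n => (ha0 n).ne') hω
  refine ⟨lp (fun _ : ℕ => Y) 1, inferInstance, inferInstance,
    inferInstance, T, ⟨1, norm_directSum_op_le⟩, ?_, ?_⟩
  · rw [UnboundedOperator.spectrum, Set.compl_empty_iff, Set.eq_univ_iff_forall]
    intro z
    obtain ⟨R, hR⟩ := hTres z
    exact hR.mem_resolventSet
  obtain ⟨R, hR⟩ := hTres 0
  refine ⟨-R, hR.isBoundedInverse, ?_⟩
  have hcnorm : ∀ n : ℕ, ‖(1 / 2 : ℂ) ^ n‖ = (1 / 2) ^ n := fun n => by simp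
  have hu : Memℓp (fun n : ℕ => ((1 / 2 : ℂ) ^ n) • y) 1 := by
    refine memℓp_gen ?_
    simp only [norm_smul, hcnorm, ENNReal.toReal_one, Real.rpow_one]
    exact (summable_geometric_of_lt_one (by norm_num) (by norm_num)).mul_right _
  have hx := memℓp_geometric_smul y w ha1
  have hux : T.HasGenerator ⟨_, hu⟩ ⟨_, hx⟩ :=
    hasGenerator_directSum_iff.2 fun n => (hyw.rescale (a n) _).smul _
  refine ⟨⟨_, hx⟩, ?_⟩
  have hRx : (-R) ⟨_, hx⟩ = ⟨_, hu⟩ := by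
    simpa using hR.left_inv _ _ hux
  rw [hRx, EReal.eq_top_iff_forall_lt]
  intro N
  refine (EReal.coe_lt_coe_iff.2 (lt_add_one N)).trans_le ?_
  refine le_limsup_of_frequently_le ?_
  rw [frequently_atTop]
  intro b
  -- At `t n` the quotient is at least `2⁻ⁿ (‖y‖ / 2) / 4⁻ⁿ ≥ n ‖y‖ / 2`; this `n` makes it at least
  -- `N + 1` and puts `t n` beyond `b`.
  obtain ⟨n, hn⟩ := exists_nat_ge (max (b : ℝ) (2 * (N + 1) / ‖y‖))
  refine ⟨t n, ?_, ?_⟩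
  · refine le_trans ?_ (htn n)
    exact_mod_cast (le_max_left _ _).trans hn
  rw [EReal.coe_le_coe_iff, le_div_iff₀ (hr_pos _)]
  have h1 : 2 * (N + 1) ≤ n * ‖y‖ := (div_le_iff₀ hy').1 ((le_max_right _ _).trans hn)
  have h2 : (1 / 2 : ℝ) ^ n * (‖y‖ / 2) ≤ ‖T.op (t n) ⟨_, hu⟩‖ := by
    refine le_trans ?_ (lp.norm_apply_le_norm one_ne_zero _ n)
    rw [hT_def, directSum_op_apply, map_smul, norm_smul, hcnorm, rescale_op]
    change _ ≤ (1 / 2 : ℝ) ^ n * ‖Complex.exp _ • S.op (a n * t n) y‖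
    rw [norm_smul, Complex.norm_exp]
    refine mul_le_mul_of_nonneg_left ?_ (by positivity)
    simpa using ha n
  refine le_trans ?_ h2
  have h3 : (n : ℝ) * (1 / 4) ^ n ≤ (1 / 2) ^ n := by
    have h4 : (n : ℝ) ≤ 2 ^ n := by exact_mod_cast n.lt_two_pow_self.le
    calc (n : ℝ) * (1 / 4) ^ n ≤ 2 ^ n * (1 / 4) ^ n := by gcongr
      _ = (1 / 2) ^ n := by rw [← mul_pow]; norm_num
  have hr0 := hr_pos (t n)
  calc (N + 1) * r (t n) ≤ n * (‖y‖ / 2) * r (t n) := by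
        refine mul_le_mul_of_nonneg_right ?_ hr0.le
        linarith
    _ ≤ n * (‖y‖ / 2) * (1 / 4) ^ n := mul_le_mul_of_nonneg_left (htr n) (by positivity)
    _ = (n * (1 / 4) ^ n) * (‖y‖ / 2) := by ring
    _ ≤ (1 / 2) ^ n * (‖y‖ / 2) := mul_le_mul_of_nonneg_right h3 (by positivity)

end C0Semigroup

theorem theorem1p2 (r : ℝ≥0 → ℝ) (hr_pos : ∀ t, 0 < r t) (hr_lim : Tendsto r atTop (𝓝 0)) :
    ∃ (X : Type) (_ : NormedAddCommGroup X) (_ : NormedSpace ℂ X) (_ : CompleteSpace X)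
      (T : C0Semigroup X),
      T.IsBounded ∧
      UnboundedOperator.spectrum T.generator = ∅ ∧
      ∃ Ainv : X →L[ℂ] X, UnboundedOperator.IsBoundedInverse T.generator Ainv ∧
        ∃ x : X,
          limsup (fun t : ℝ≥0 => ((‖T.op t (Ainv x)‖ / r t : ℝ) : EReal)) atTop = ⊤ := by
  have hS : ∀ t, ‖GaussianShift.semigroup.op t‖ ≤ 1 := fun t =>
    (GaussianShift.norm_semigroup_op_le t).trans (Real.exp_le_one_iff.2 (by simp))
  exact C0Semigroup.exists_arbitrarily_slow_decay hS four_pos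
    (fun t x y ht => GaussianShift.norm_semigroup_op_generator_le ht)
    (C0Semigroup.exists_isResolvent_of_gaussian_decay
      (C0Semigroup.IsBounded.continuousOrbits ⟨1, hS⟩) GaussianShift.norm_semigroup_op_le)
    hr_pos hr_lim
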